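/- **Setting.** Let $AP$ be a finite set of atomic propositions, $A$ a finite set of attributes and $\Delta$ an infinite set of data values. A data word is a finite or infinite sequence $w=(a_0,\vec d_0)(a_1,\vec d_1)\dots$ with $a_i\subseteq AP$ and $\vec d_i:A\to\Delta$; its positions are the $i$ with $0\le i<|w|$. **BD-LTL** consists of position formulae $\varphi$ and class formulae $\psi$ given by $$\varphi ::= p\mid\varphi\wedge\varphi\mid\neg\varphi\mid \mathrm X\varphi\mid \mathrm Y\varphi\mid\varphi\,\mathrm U\,\varphi\mid\varphi\,\mathrm S\,\varphi\mid \mathrm C^r_x\psi,$$ $$\psi ::= @x\mid\psi\wedge\psi\mid\neg\psi\mid \mathrm X^=\psi\mid \mathrm Y^=\psi\mid\psi\,\mathrm U^=\psi\mid\psi\,\mathrm S^=\psi\mid\varphi,$$ with $p\in AP$, $x\in A$, $r\in\mathbb Z$. Position formulae are evaluated at $(w,i)$ and class formulae at $(w,i,d)$, where $i$ is a position of $w$ and $d\in\Delta$. The proposition $p$ holds at $(w,i)$ iff $p\in a_i$; Boolean operators and the LTL operators $\mathrm X$ (next), $\mathrm Y$ (previous), $\mathrm U$ (until), $\mathrm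 S$ (since) have their usual meaning on $w$, where $\mathrm X$ and $\mathrm Y$ require the next, respectively previous, position to exist and $\mathrm U$, $\mathrm S$ are non-strict. Let $\mathrm{pos}_d(w)$ be the set of positions $i$ of $w$ with $\vec d_i(x)=d$ for some $x\in A$. Then * $(w,i)\models \mathrm C^r_x\psi$ iff $0\le i+r<|w|$ and $(w,i+r,\vec d_i(x))\models\psi$; * $(w,i,d)\models @x$ iff $\vec d_i(x)=d$, and $(w,i,d)\models\varphi$ iff $(w,i)\models\varphi$; * $(w,i,d)\models \mathrm X^=\psi$ iff there is $j\in\mathrm{pos}_d(w)$ with $j>i$ and, for the smallest such $j$, $(w,j,d)\models\psi$; * $(w,i,d)\models\psi_1\mathrm U^=\psi_2$ iff there is $j\in\mathrm{pos}_d(w)$ with $j\ge i$ and $(w,j,d)\models\psi_2$ such that $(w,j',d)\models\psi_1$ for all $j'\in\mathrm{pos}_d(w)$ with $i\le j'<j$; * $\mathrm Y^=$ and $\mathrm S^=$ are the mirror images of $\mathrm X^=$ and $\mathrm U^=$ towards the past. **BD-LTL$^+$** is the set of position formulae in which neither $\mathrm Y^=$ nor $\mathrm S^=$ occurs. **LRV$^\top$**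 is LTL over $AP$ with the operators $\wedge,\neg,\mathrm X,\mathrm Y,\mathrm U,\mathrm S$ as above and, in addition, the formulae $x\approx \mathrm X^r y$ and $x\approx\langle\top?\rangle y$ for $x,y\in A$, $r\in\mathbb N$. Here $(w,i)\models x\approx \mathrm X^r y$ iff $i+r<|w|$ and $\vec d_{i+r}(y)=\vec d_i(x)$, and $(w,i)\models x\approx\langle\top?\rangle y$ iff there is a position $j>i$ of $w$ with $\vec d_j(y)=\vec d_i(x)$. For a formula $\chi$ of either logic, $w\models\chi$ means that $w$ is non-empty and $(w,0)\models\chi$. **Proposition.** BD-LTL$^+$ is strictly more expressive than LRV$^\top$: 1. For every LRV$^\top$ formula $\theta$ there is a BD-LTL$^+$ formula $\varphi$ such that $(w,i)\models\theta\iff(w,i)\models\varphi$ for all data words $w$ and all positions $i$ of $w$. 2. If $A\neq\emptyset$, there is a BD-LTL$^+$ formula $\varphi$, in which $\mathrm X^=$ occurs and is the only one of the operators $\mathrm X^=,\mathrm Y^=,\mathrm U^=,\mathrm S^=$ that occurs, that is not expressible in LRV$^\top$, neither over finite nor over infinite data words: for every LRV$^\top$ formula $\theta$ there are a finite data word $w$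 and an infinite data word $w'$ such that exactly one of $w\models\theta$, $w\models\varphi$ holds and exactly one of $w'\models\theta$, $w'\models\varphi$ holds. -/

import Mathlib

namespace DataLogic

universe u v w

/-- An `A`-attributed data word over the alphabet `2^AP` with data values in `Δ`: a finite or
infinite sequence (of length `len`, possibly `⊤` or `0`) of pairs of a letter and a data
valuation. -/
structure DataWord (AP : Type u) (A : Type v) (Δ : Type w) where
  len : ℕ∞
  letter : {i : ℕ // (i : ℕ∞) < len} → Set AP
  val : {i : ℕ // (i : ℕ∞) < len} → A → Δ

namespace DataWord

variable {AP : Type u} {A : Type v} {Δ : Type w}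

/-- The positions `0 ≤ i < |W|` of a data word `W`. -/
abbrev Pos (W : DataWord AP A Δ) : Type := {i : ℕ // (i : ℕ∞) < W.len}

/-- The set `pos_d(W)` of the positions at which some attribute has the value `d`. -/
def posOf (W : DataWord AP A Δ) (d : Δ) : Set W.Pos := {i | ∃ x, W.val i x = d}

end DataWord

mutual

/-- Position formulae of BD-LTL. -/
inductive PosFormula (AP : Type u) (A : Type v) : Type (max u v)
  | atom (p : AP)
  | and (φ₁ φ₂ : PosFormula AP A)
  | neg (φ : PosFormula AP A)
  /-- `X φ` -/
  | next (φ : PosFormula AP A)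
  /-- `Y φ` -/
  | prev (φ : PosFormula AP A)
  /-- `φ₁ U φ₂` -/
  | untl (φ₁ φ₂ : PosFormula AP A)
  /-- `φ₁ S φ₂` -/
  | snce (φ₁ φ₂ : PosFormula AP A)
  /-- the class quantifier `C_x^r ψ` -/
  | cls (x : A) (r : ℤ) (ψ : ClassFormula AP A)

/-- Class formulae of BD-LTL. -/
inductive ClassFormula (AP : Type u) (A : Type v) : Type (max u v)
  /-- `@x` -/
  | at (x : A)
  | and (ψ₁ ψ₂ : ClassFormula AP A)
  | neg (ψ : ClassFormula AP A)
  /-- `X^= ψ` -/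
  | nextEq (ψ : ClassFormula AP A)
  /-- `Y^= ψ` -/
  | prevEq (ψ : ClassFormula AP A)
  /-- `ψ₁ U^= ψ₂` -/
  | untlEq (ψ₁ ψ₂ : ClassFormula AP A)
  /-- `ψ₁ S^= ψ₂` -/
  | snceEq (ψ₁ ψ₂ : ClassFormula AP A)
  /-- a position formula used as a class formula -/
  | pos (φ : PosFormula AP A)

end

mutual

/-- `(W, i) ⊨ φ` for BD-LTL position formulae. -/
def PosFormula.Sat {AP : Type u} {A : Type v} {Δ : Type w} (W : DataWord AP A Δ) :
    PosFormula AP A → W.Pos → Prop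
  | .atom p, i => p ∈ W.letter i
  | .and φ₁ φ₂, i => φ₁.Sat W i ∧ φ₂.Sat W i
  | .neg φ, i => ¬ φ.Sat W i
  | .next φ, i => ∃ j : W.Pos, j.1 = i.1 + 1 ∧ φ.Sat W j
  | .prev φ, i => ∃ j : W.Pos, j.1 + 1 = i.1 ∧ φ.Sat W j
  | .untl φ₁ φ₂, i => ∃ j : W.Pos, i ≤ j ∧ φ₂.Sat W j ∧ ∀ k : W.Pos, i ≤ k → k < j → φ₁.Sat W k
  | .snce φ₁ φ₂, i => ∃ j : W.Pos, j ≤ i ∧ φ₂.Sat W j ∧ ∀ k : W.Pos, j < k → k ≤ i → φ₁.Sat W k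
  | .cls x r ψ, i => ∃ j : W.Pos, (j.1 : ℤ) = (i.1 : ℤ) + r ∧ ψ.Sat W j (W.val i x)

/-- `(W, i, d) ⊨ ψ` for BD-LTL class formulae. -/
def ClassFormula.Sat {AP : Type u} {A : Type v} {Δ : Type w} (W : DataWord AP A Δ) :
    ClassFormula AP A → W.Pos → Δ → Prop
  | .at x, i, d => W.val i x = d
  | .and ψ₁ ψ₂, i, d => ψ₁.Sat W i d ∧ ψ₂.Sat W i d
  | .neg ψ, i, d => ¬ ψ.Sat W i d
  | .nextEq ψ, i, d => ∃ j : W.Pos, IsLeast {j | j ∈ W.posOf d ∧ i < j} j ∧ ψ.Sat W j d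
  | .prevEq ψ, i, d => ∃ j : W.Pos, IsGreatest {j | j ∈ W.posOf d ∧ j < i} j ∧ ψ.Sat W j d
  | .untlEq ψ₁ ψ₂, i, d => ∃ j ∈ W.posOf d, i ≤ j ∧ ψ₂.Sat W j d ∧
      ∀ k ∈ W.posOf d, i ≤ k → k < j → ψ₁.Sat W k d
  | .snceEq ψ₁ ψ₂, i, d => ∃ j ∈ W.posOf d, j ≤ i ∧ ψ₂.Sat W j d ∧
      ∀ k ∈ W.posOf d, j < k → k ≤ i → ψ₁.Sat W k d
  | .pos φ, i, _ => φ.Sat W i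

end

/-- The class navigation operators `X^=`, `Y^=`, `U^=`, `S^=`. -/
inductive ClassOp
  | nextEq
  | prevEq
  | untlEq
  | snceEq

mutual

/-- The set of the class navigation operators that occur in a position formula. -/
def PosFormula.classOps {AP : Type u} {A : Type v} : PosFormula AP A → Set ClassOp
  | .atom _ => ∅
  | .and φ₁ φ₂ => φ₁.classOps ∪ φ₂.classOps
  | .neg φ => φ.classOps
  | .next φ => φ.classOps
  | .prev φ => φ.classOps
  | .untl φ₁ φ₂ => φ₁.classOps ∪ φ₂.classOps
  | .snce φ₁ φ₂ => φ₁.classOps ∪ φ₂.classOps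
  | .cls _ _ ψ => ψ.classOps

/-- The set of the class navigation operators that occur in a class formula. -/
def ClassFormula.classOps {AP : Type u} {A : Type v} : ClassFormula AP A → Set ClassOp
  | .at _ => ∅
  | .and ψ₁ ψ₂ => ψ₁.classOps ∪ ψ₂.classOps
  | .neg ψ => ψ.classOps
  | .nextEq ψ => {ClassOp.nextEq} ∪ ψ.classOps
  | .prevEq ψ => {ClassOp.prevEq} ∪ ψ.classOps
  | .untlEq ψ₁ ψ₂ => {ClassOp.untlEq} ∪ (ψ₁.classOps ∪ ψ₂.classOps)
  | .snceEq ψ₁ ψ₂ => {ClassOp.snceEq} ∪ (ψ₁.classOps ∪ ψ₂.classOps)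
  | .pos φ => φ.classOps

end

/-- The fragment BD-LTL⁺: neither `Y^=` nor `S^=` occurs. -/
def PosFormula.IsPlus {AP : Type u} {A : Type v} (φ : PosFormula AP A) : Prop :=
  ClassOp.prevEq ∉ φ.classOps ∧ ClassOp.snceEq ∉ φ.classOps

/-- `W ⊨ φ`, i.e. `(W, 0) ⊨ φ`. -/
def PosFormula.Models {AP : Type u} {A : Type v} {Δ : Type w} (W : DataWord AP A Δ)
    (φ : PosFormula AP A) : Prop :=
  ∃ h : ((0 : ℕ) : ℕ∞) < W.len, φ.Sat W ⟨0, h⟩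

/-- The logic LRV^⊤: LTL with past operators, extended by the operators `x ≈ X^r y` and
`x ≈ ⟨⊤?⟩ y`. -/
inductive LRVTop (AP : Type u) (A : Type v) : Type (max u v)
  | atom (p : AP)
  | and (θ₁ θ₂ : LRVTop AP A)
  | neg (θ : LRVTop AP A)
  | next (θ : LRVTop AP A)
  | prev (θ : LRVTop AP A)
  | untl (θ₁ θ₂ : LRVTop AP A)
  | snce (θ₁ θ₂ : LRVTop AP A)
  /-- `x ≈ X^r y` -/
  | eqNext (x : A) (r : ℕ) (y : A)
  /-- `x ≈ ⟨⊤?⟩ y` -/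
  | eqLater (x y : A)

/-- `(W, i) ⊨ θ` for LRV^⊤ formulae. -/
def LRVTop.Sat {AP : Type u} {A : Type v} {Δ : Type w} (W : DataWord AP A Δ) :
    LRVTop AP A → W.Pos → Prop
  | .atom p, i => p ∈ W.letter i
  | .and θ₁ θ₂, i => θ₁.Sat W i ∧ θ₂.Sat W i
  | .neg θ, i => ¬ θ.Sat W i
  | .next θ, i => ∃ j : W.Pos, j.1 = i.1 + 1 ∧ θ.Sat W j
  | .prev θ, i => ∃ j : W.Pos, j.1 + 1 = i.1 ∧ θ.Sat W j
  | .untl θ₁ θ₂, i => ∃ j : W.Pos, i ≤ j ∧ θ₂.Sat W j ∧ ∀ k : W.Pos, i ≤ k → k < j → θ₁.Sat W k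
  | .snce θ₁ θ₂, i => ∃ j : W.Pos, j ≤ i ∧ θ₂.Sat W j ∧ ∀ k : W.Pos, j < k → k ≤ i → θ₁.Sat W k
  | .eqNext x r y, i => ∃ j : W.Pos, j.1 = i.1 + r ∧ W.val j y = W.val i x
  | .eqLater x y, i => ∃ j : W.Pos, i < j ∧ W.val j y = W.val i x

/-- `W ⊨ θ`, i.e. `(W, 0) ⊨ θ`. -/
def LRVTop.Models {AP : Type u} {A : Type v} {Δ : Type w} (W : DataWord AP A Δ)
    (θ : LRVTop AP A) : Prop :=
  ∃ h : ((0 : ℕ) : ℕ∞) < W.len, θ.Sat W ⟨0, h⟩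

end DataLogic

namespace DataLogic

universe u v w

-- For part 1 only the data atoms need work: a shifted equality is a class quantifier with that
-- shift, and a future repetition is `U^=` with a trivially true left argument. For part 2, take `n
-- = θ.maxShift` and compare the words `d cⁿ d d e c …` and `e cⁿ d d e c …`, which differ only at
-- position 0. The data atoms of LRV^⊤ look only forward, so they can differ at most at position 0.
-- There, shifts up to `n` meet only the filler `c`, and the initial value recurs later in both
-- words; hence `θ` cannot separate them (`LRVTop.models_repeatSeq_iff`). But `stutterNext` does:
-- the next `d` is followed by `d`, the next `e` is not followed by `e`. So `θ` disagrees with it on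
-- one of the two words.

/-- The translation of LRV^⊤ into BD-LTL⁺. -/
def LRVTop.toPos {AP : Type u} {A : Type v} : LRVTop AP A → PosFormula AP A
  | .atom p => .atom p
  | .and θ₁ θ₂ => .and θ₁.toPos θ₂.toPos
  | .neg θ => .neg θ.toPos
  | .next θ => .next θ.toPos
  | .prev θ => .prev θ.toPos
  | .untl θ₁ θ₂ => .untl θ₁.toPos θ₂.toPos
  | .snce θ₁ θ₂ => .snce θ₁.toPos θ₂.toPos
  | .eqNext x r y => .cls x r (.at y)
  -- The shift 1 makes the non-strict `U^=` range over strictly later positions; the negated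
  -- contradiction serves as "true".
  | .eqLater x y => .cls x 1 (.untlEq (.neg (.and (.at x) (.neg (.at x)))) (.at y))

theorem LRVTop.toPos_isPlus {AP : Type u} {A : Type v} (θ : LRVTop AP A) : θ.toPos.IsPlus := by
  induction θ <;>
    simp_all [LRVTop.toPos, PosFormula.IsPlus, PosFormula.classOps, ClassFormula.classOps]

theorem LRVTop.sat_toPos {AP : Type u} {A : Type v} {Δ : Type w} (W : DataWord AP A Δ)
    (θ : LRVTop AP A) (i : W.Pos) : θ.Sat W i ↔ θ.toPos.Sat W i := by
  induction θ generalizing i with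
  | eqNext x r y =>
    simp only [LRVTop.toPos, LRVTop.Sat, PosFormula.Sat, ClassFormula.Sat]
    exact exists_congr fun j => and_congr_left fun _ => by omega
  | eqLater x y =>
    simp only [LRVTop.toPos, LRVTop.Sat, PosFormula.Sat, ClassFormula.Sat, and_not_self,
      not_false_eq_true, implies_true, and_true]
    constructor
    · rintro ⟨j, hij, hj⟩
      have hij' : i.1 < j.1 := hij
      have hlt : ((i.1 + 1 : ℕ) : ℕ∞) < W.len :=
        lt_of_le_of_lt (Nat.cast_le.mpr hij') j.2
      exact ⟨⟨i.1 + 1, hlt⟩, by simp, j, ⟨y, hj⟩, hij', hj⟩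
    · rintro ⟨k, hk, j, -, hkj, hj⟩
      have hkj' : k.1 ≤ j.1 := hkj
      exact ⟨j, show i.1 < j.1 by omega, hj⟩
  | _ => simp_all [LRVTop.toPos, LRVTop.Sat, PosFormula.Sat]

/-- An upper bound for the shifts `r` of the subformulae `x ≈ X^r y`. -/
def LRVTop.maxShift {AP : Type u} {A : Type v} : LRVTop AP A → ℕ
  | .atom _ => 0
  | .and θ₁ θ₂ => max θ₁.maxShift θ₂.maxShift
  | .neg θ => θ.maxShift
  | .next θ => θ.maxShift
  | .prev θ => θ.maxShift
  | .untl θ₁ θ₂ => max θ₁.maxShift θ₂.maxShift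
  | .snce θ₁ θ₂ => max θ₁.maxShift θ₂.maxShift
  | .eqNext _ r _ => r
  | .eqLater _ _ => 0

/-- The data word of length `L` without propositions all of whose attributes have the value `f i`
at position `i`. -/
def constWord (AP : Type u) (A : Type v) {Δ : Type w} (L : ℕ∞) (f : ℕ → Δ) : DataWord AP A Δ where
  len := L
  letter _ := ∅
  val i _ := f i.1

/-- LRV^⊤ only sees which positions repeat their value at a bounded distance and which repeat it
at all in the future. -/
theorem LRVTop.sat_constWord_iff {AP : Type u} {A : Type v} {Δ : Type w} {L : ℕ∞} {f g : ℕ → Δ}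
    {n : ℕ} (hnext : ∀ i r, r ≤ n → (f (i + r) = f i ↔ g (i + r) = g i))
    (hlater : ∀ i, (∃ j : ℕ, (j : ℕ∞) < L ∧ i < j ∧ f j = f i) ↔
      ∃ j : ℕ, (j : ℕ∞) < L ∧ i < j ∧ g j = g i)
    (θ : LRVTop AP A) (hθ : θ.maxShift ≤ n) (i : {i : ℕ // (i : ℕ∞) < L}) :
    θ.Sat (constWord AP A L f) i ↔ θ.Sat (constWord AP A L g) i := by
  induction θ generalizing i with
  | atom p => exact Iff.rfl
  | and θ₁ θ₂ ih₁ ih₂ =>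
    have h := max_le_iff.mp hθ
    exact and_congr (ih₁ h.1 i) (ih₂ h.2 i)
  | neg θ ih => exact not_congr (ih hθ i)
  | next θ ih => exact exists_congr fun j => and_congr_right fun _ => ih hθ j
  | prev θ ih => exact exists_congr fun j => and_congr_right fun _ => ih hθ j
  | untl θ₁ θ₂ ih₁ ih₂ =>
    have h := max_le_iff.mp hθ
    exact exists_congr fun j => and_congr_right fun _ => and_congr (ih₂ h.2 j) <|
      forall_congr' fun k => imp_congr_right fun _ => imp_congr_right fun _ => ih₁ h.1 k
  | snce θ₁ θ₂ ih₁ ih₂ =>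
    have h := max_le_iff.mp hθ
    exact exists_congr fun j => and_congr_right fun _ => and_congr (ih₂ h.2 j) <|
      forall_congr' fun k => imp_congr_right fun _ => imp_congr_right fun _ => ih₁ h.1 k
  | eqNext x r y =>
    refine exists_congr fun j => and_congr_right fun (hj : j.1 = i.1 + r) => ?_
    change f j.1 = f i.1 ↔ g j.1 = g i.1
    rw [hj]
    exact hnext _ _ hθ
  | eqLater x y =>
    have h := hlater i.1
    constructor
    · rintro ⟨j, hij, hj⟩
      obtain ⟨k, hk, hik, hgk⟩ := h.mp ⟨j.1, j.2, hij, hj⟩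
      exact ⟨⟨k, hk⟩, hik, hgk⟩
    · rintro ⟨j, hij, hj⟩
      obtain ⟨k, hk, hik, hfk⟩ := h.mpr ⟨j.1, j.2, hij, hj⟩
      exact ⟨⟨k, hk⟩, hik, hfk⟩

/-- The sequence `s cⁿ d d e c c c …`. -/
def repeatSeq {Δ : Type w} (c d e : Δ) (n : ℕ) (s : Δ) (i : ℕ) : Δ :=
  if i = 0 then s else if i = n + 1 ∨ i = n + 2 then d else if i = n + 3 then e else c

section repeatSeq

variable {Δ : Type w} {c d e : Δ} {n : ℕ} {s : Δ}

@[simp] theorem repeatSeq_zero : repeatSeq c d e n s 0 = s := by simp [repeatSeq]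

@[simp] theorem repeatSeq_first : repeatSeq c d e n s (n + 1) = d := by simp [repeatSeq]

@[simp] theorem repeatSeq_second : repeatSeq c d e n s (n + 2) = d := by simp [repeatSeq]

@[simp] theorem repeatSeq_third : repeatSeq c d e n s (n + 3) = e := by simp [repeatSeq]

@[simp] theorem repeatSeq_fourth : repeatSeq c d e n s (n + 4) = c := by simp [repeatSeq]

theorem repeatSeq_filler {i : ℕ} (h₀ : i ≠ 0) (h : i ≤ n) : repeatSeq c d e n s i = c := by
  unfold repeatSeq
  rw [if_neg h₀, if_neg (by omega), if_neg (by omega)]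

theorem repeatSeq_congr (s t : Δ) {i : ℕ} (h₀ : i ≠ 0) :
    repeatSeq c d e n s i = repeatSeq c d e n t i := by
  simp [repeatSeq, h₀]

end repeatSeq

theorem LRVTop.models_repeatSeq_iff {AP : Type u} {A : Type v} {Δ : Type w} {c d e : Δ}
    (hcd : c ≠ d) (hce : c ≠ e) {L : ℕ∞} (θ : LRVTop AP A) {n : ℕ} (hθ : θ.maxShift ≤ n)
    (hL : ((n + 3 : ℕ) : ℕ∞) < L) :
    θ.Models (constWord AP A L (repeatSeq c d e n d)) ↔
      θ.Models (constWord AP A L (repeatSeq c d e n e)) := by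
  refine exists_congr fun h => θ.sat_constWord_iff (n := n) ?_ ?_ hθ ⟨0, h⟩
  · intro i r hr
    rcases Nat.eq_zero_or_pos r with rfl | hr₀
    · simp
    rcases Nat.eq_zero_or_pos i with rfl | hi
    -- Both equalities fail: position `r` carries `c`, which differs from both initial values.
    · simp [repeatSeq_filler hr₀.ne' hr, hcd, hce]
    · rw [repeatSeq_congr d e (by omega), repeatSeq_congr d e (by omega : i ≠ 0)]
  · intro i
    rcases Nat.eq_zero_or_pos i with rfl | hi
    -- The initial `d` recurs at `n + 1`, the initial `e` at `n + 3`.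
    · refine iff_of_true ⟨n + 1, lt_of_le_of_lt ?_ hL, by omega, by simp⟩
        ⟨n + 3, hL, by omega, by simp⟩
      exact Nat.cast_le.mpr (by omega)
    · refine exists_congr fun j => and_congr_right fun _ => and_congr_right fun hj => ?_
      rw [repeatSeq_congr d e (by omega), repeatSeq_congr d e (by omega : i ≠ 0)]

/-- `C⁰_x X^= C¹_x @x`: at the next position carrying the current value of `x`, the attribute `x`
keeps its value for one more step. -/
def stutterNext (AP : Type u) {A : Type v} (x : A) : PosFormula AP A :=
  .cls x 0 (.nextEq (.pos (.cls x 1 (.at x))))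

theorem classOps_stutterNext (AP : Type u) {A : Type v} (x : A) :
    (stutterNext AP x).classOps = {ClassOp.nextEq} := by
  simp [stutterNext, PosFormula.classOps, ClassFormula.classOps]

/-- Here `m` is the first return to the initial value, hence the position reached by `X^=`. The
length condition on the right is the demand of `C¹` that a successor exist. -/
theorem models_constWord_stutterNext_iff {AP : Type u} {A : Type v} {Δ : Type w} (x : A) {L : ℕ∞}
    {f : ℕ → Δ} {m : ℕ} (hm : 0 < m) (hmL : (m : ℕ∞) < L) (hf : f m = f 0)
    (hmin : ∀ k, 0 < k → k < m → f k ≠ f 0) :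
    (stutterNext AP x).Models (constWord AP A L f) ↔
      ((m + 1 : ℕ) : ℕ∞) < L ∧ f (m + 1) = f m := by
  simp only [PosFormula.Models, stutterNext, PosFormula.Sat, ClassFormula.Sat]
  constructor
  · rintro ⟨h, i, hi, j, ⟨⟨⟨a, hja⟩, hij⟩, hleast⟩, k, hk, hkj⟩
    have hi₀ : i.1 = 0 := by simpa using hi
    have hij' : i.1 < j.1 := hij
    have hjm : j.1 ≤ m := hleast (a := ⟨m, hmL⟩) ⟨⟨x, hf⟩, show i.1 < m by omega⟩
    have hmj : j.1 = m := by
      by_contra hne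
      exact hmin j.1 (by omega) (by omega) hja
    have hkm : k.1 = m + 1 := by omega
    have hkj' : f k.1 = f j.1 := hkj
    rw [hkm, hmj] at hkj'
    exact ⟨hkm ▸ k.2, hkj'⟩
  · rintro ⟨hL, hfm⟩
    have h₀ : ((0 : ℕ) : ℕ∞) < L := lt_of_le_of_lt (Nat.cast_le.mpr hm.le) hmL
    refine ⟨h₀, ⟨0, h₀⟩, by simp, ⟨m, hmL⟩, ⟨⟨⟨x, hf⟩, hm⟩, ?_⟩, ⟨m + 1, hL⟩, by simp, hfm⟩
    rintro k ⟨⟨a, hka⟩, hk⟩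
    by_contra hlt
    exact hmin k.1 hk (lt_of_not_ge hlt) hka

theorem exists_not_models_iff_stutterNext {AP : Type u} {A : Type v} {Δ : Type w} [Infinite Δ]
    (x : A) (θ : LRVTop AP A) {L : ℕ∞} (hL : ((θ.maxShift + 3 : ℕ) : ℕ∞) < L) :
    ∃ W : DataWord AP A Δ, W.len = L ∧ ¬ (θ.Models W ↔ (stutterNext AP x).Models W) := by
  let a : ℕ ↪ Δ := Infinite.natEmbedding Δ
  have hcd : a 0 ≠ a 1 := a.injective.ne (by decide)
  have hce : a 0 ≠ a 2 := a.injective.ne (by decide)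
  have hde : a 1 ≠ a 2 := a.injective.ne (by decide)
  generalize a 0 = c, a 1 = d, a 2 = e at hcd hce hde
  set n := θ.maxShift with hn
  have hlt : ∀ {m : ℕ}, m ≤ n + 3 → (m : ℕ∞) < L := fun h =>
    lt_of_le_of_lt (Nat.cast_le.mpr h) hL
  have hd : (stutterNext AP x).Models (constWord AP A L (repeatSeq c d e n d)) := by
    refine (models_constWord_stutterNext_iff x (m := n + 1) (by omega) (hlt (by omega)) (by simp)
      fun k hk hkm => ?_).mpr ⟨hlt (by omega), by simp⟩
    simpa [repeatSeq_filler hk.ne' (Nat.lt_succ_iff.mp hkm)] using hcd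
  have he : ¬ (stutterNext AP x).Models (constWord AP A L (repeatSeq c d e n e)) := by
    intro h
    have h' := (models_constWord_stutterNext_iff x (m := n + 3) (by omega) hL (by simp)
      fun k hk hkm => ?_).mp h
    -- Position `n + 4`, if it exists, carries `c ≠ e`; the argument thus covers both finite and
    -- infinite `L`.
    · simp [hce] at h'
    · rcases Nat.lt_or_ge n k with hnk | hnk
      · obtain rfl | rfl : k = n + 1 ∨ k = n + 2 := by omega
        all_goals simpa using hde
      · simpa [repeatSeq_filler hk.ne' hnk] using hce
  have hθ := θ.models_repeatSeq_iff hcd hce hn.ge hL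
  -- If `θ` holds on the `d`-word, it also holds on the `e`-word, where `stutterNext` fails;
  -- otherwise the `d`-word itself is the witness.
  by_cases h : θ.Models (constWord AP A L (repeatSeq c d e n d))
  · exact ⟨_, rfl, fun hiff => he (hiff.mp (hθ.mp h))⟩
  · exact ⟨_, rfl, fun hiff => h (hiff.mpr hd)⟩

end DataLogic

theorem mainTheorem9 (AP A Δ : Type*) [Finite AP] [Finite A] [Infinite Δ] :
    (∀ θ : DataLogic.LRVTop AP A, ∃ φ : DataLogic.PosFormula AP A, φ.IsPlus ∧
      ∀ (W : DataLogic.DataWord AP A Δ) (i : W.Pos), θ.Sat W i ↔ φ.Sat W i) ∧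
    (Nonempty A → ∃ φ : DataLogic.PosFormula AP A, φ.IsPlus ∧
      φ.classOps = {DataLogic.ClassOp.nextEq} ∧
      ∀ θ : DataLogic.LRVTop AP A,
        (∃ W : DataLogic.DataWord AP A Δ, W.len ≠ ⊤ ∧ ¬ (θ.Models W ↔ φ.Models W)) ∧
        (∃ W : DataLogic.DataWord AP A Δ, W.len = ⊤ ∧ ¬ (θ.Models W ↔ φ.Models W))) := by
  refine ⟨fun θ => ⟨θ.toPos, θ.toPos_isPlus, fun W i => θ.sat_toPos W i⟩, ?_⟩
  rintro ⟨x⟩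
  refine ⟨DataLogic.stutterNext AP x, ?_, DataLogic.classOps_stutterNext AP x, fun θ => ⟨?_, ?_⟩⟩
  · simp [DataLogic.PosFormula.IsPlus, DataLogic.classOps_stutterNext]
  -- `maxShift + 4` is the least length containing the position of `e`.
  · obtain ⟨W, hW, h⟩ := DataLogic.exists_not_models_iff_stutterNext (Δ := Δ) x θ
      (L := ((θ.maxShift + 4 : ℕ) : ℕ∞)) (Nat.cast_lt.mpr (by omega))
    exact ⟨W, hW ▸ ENat.natCast_ne_top _, h⟩
  · exact DataLogic.exists_not_models_iff_stutterNext x θ (ENat.natCast_lt_top _)
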